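/- **Model.** An IoT device can offload a fraction $x\in\{l/N_x:0\le l\le N_x\}$ ($N_x\ge1$) of a computation task of $C>0$ bits to one of $M$ MEC devices; an action is $\mathbf a=[i,x]$, $1\le i\le M$. Let $N,f,\varsigma,P>0$ (CPU cycles per bit, CPU frequency, effective capacitance coefficient, transmit power) and $\beta,\mu,\psi\ge0$ (weights of energy and delay, task drop loss). In a time slot with bandwidths $B_1,\dots,B_M>0$, battery level $b$ and harvested energy $\rho$, set $$E_0=(1-x)CN\varsigma f^2,\quad T_0=\frac{(1-x)CN}{f},\quad E_i=\frac{PxC}{B_i},\quad T_i=\frac{xC}{B_i},$$ $$U_i(x)=xC-\psi\,\mathbf I\big(b-(E_0+E_i)+\rho\le0\big)-\beta(E_0+E_i)-\mu\max\{T_0,T_i\}.$$ In slot $k$ the system state is $\mathbf s^{(k)}=[B_1^{(k-1)},\dots,B_M^{(k-1)},\hat\rho^{(k)},b^{(k)}]$, where $\hat\rho^{(k)}$ is the predicted harvested energy; the bandwidth vectors, the predictions and the battery levels each range over a finite set. Given the past of slot $k$, the triple $(B^{(k)},\rho^{(k)},\hat\rho^{(k+1)})$ is independent of the action $\mathbf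 a^{(k)}$ and has a law determined by $(B^{(k-1)},\hat\rho^{(k)})$ only. The battery evolves by $b^{(k+1)}=\kappa\big(b^{(k)}-(E_0^{(k)}+E_i^{(k)})+\rho^{(k)}\big)$, where $\kappa$ is a nondecreasing map from $\mathbb R$ to the finite set of feasible battery levels. The device runs tabular $\varepsilon$-greedy Q-learning from an arbitrary initial table (for example the one produced by hotbooting): with $g^{(k)}$ a maximizer of $Q^{(k)}(\mathbf s^{(k)},\cdot)$, ties being broken arbitrarily, it takes $g^{(k)}$ with probability $1-\varepsilon$ and otherwise an action drawn uniformly from all $(N_x+1)M$ actions, where $0<\varepsilon\le1$. It then updates the entry of the pair $(\mathbf s^{(k)},\mathbf a^{(k)})$ by $$Q\leftarrow(1-\alpha_n)Q+\alpha_n\Big(U^{(k)}+\gamma\max_{\mathbf a}Q^{(k)}(\mathbf s^{(k+1)},\mathbf a)\Big),$$ where $U^{(k)}$ is the utility obtained in slot $k$, $n$ is the number of earlier visits to that pair, $0\le\gamma<1$, $\alpha_n\in[0,1]$, $\sum_n\alpha_n=\infty$ and $\sum_n\alpha_n^2<\infty$. **Theorem 1.** Let $i^*$ be an MEC device with $B_{i^*}=\max_{1\le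 i\le M}B_i$ for every feasible bandwidth vector, and suppose that for every feasible bandwidth vector $$\max\left\{\frac{\mu+\beta P}{\beta\varsigma Nf^2+1},\ \frac{P}{\varsigma Nf^2}\right\}\le B_{i^*}.$$ 1. In every single slot, that is, for every feasible bandwidth vector and all real $b,\rho$, full offloading $[i^*,1]$ maximizes $U_i(x)$ over all $1\le i\le M$ and $0\le x\le1$, and its utility is $$U=C\,\frac{B_{i^*}-\beta P-\mu}{B_{i^*}}-\psi\,\mathbf I\Big(b-\frac{PC}{B_{i^*}}+\rho\le0\Big).\qquad(*)$$ 2. With probability 1, from some slot on the greedy action $g^{(k)}$ of the Q-learning scheme has, in slot $k$, exactly the utility of $[i^*,1]$, which is given by $(*)$ with $B_{i^*}=B_{i^*}^{(k)}$, $b=b^{(k)}$, $\rho=\rho^{(k)}$. Moreover, with probability 1, $\max_{\mathbf a}Q^{(k)}(\mathbf s^{(k)},\mathbf a)-Q^{(k)}(\mathbf s^{(k)},[i^*,1])\to0$ as $k\to\infty$. 3. If $\mu+\beta P>0$ and, for every feasible bandwidth vector, $(\mu+\beta P)/(\beta\varsigma Nf^2+1)<B_{i^*}$ and $B_i<B_{i^*}$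 for all $i\ne i^*$, then with probability 1 the greedy action is $g^{(k)}=[i^*,1]$ from some slot on. -/

import Mathlib

open MeasureTheory Filter Topology

noncomputable section

namespace MEC

/-- The fixed parameters of the network: an IoT device and `M` MEC devices. -/
structure Params where
  /-- number of MEC devices -/
  M : ℕ
  /-- the offloading rate takes the `Nx + 1` values `l / Nx`, `0 ≤ l ≤ Nx` -/
  Nx : ℕ
  /-- size (bits) of the computation task of a time slot -/
  C : ℝ
  /-- CPU cycles needed per bit -/
  N : ℝ
  /-- CPU-cycle frequency of the IoT device, the same for all cycles -/
  f : ℝ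
  /-- effective capacitance coefficient of the chip -/
  cap : ℝ
  /-- transmit power -/
  P : ℝ
  /-- weight of the energy consumption -/
  β : ℝ
  /-- weight of the computation delay -/
  μ : ℝ
  /-- task drop loss -/
  ψ : ℝ
  Nx_pos : 0 < Nx
  C_pos : 0 < C
  N_pos : 0 < N
  f_pos : 0 < f
  cap_pos : 0 < cap
  P_pos : 0 < P
  β_nonneg : 0 ≤ β
  μ_nonneg : 0 ≤ μ
  ψ_nonneg : 0 ≤ ψ

namespace Params

variable (p : Params)

/-- An action `[i, x]`: the chosen MEC device and the index `l` of the rate `x = l / Nx`. -/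
abbrev Action : Type := Fin p.M × Fin (p.Nx + 1)

/-- The offloading rate `x` of an action. -/
def rate (a : p.Action) : ℝ := (a.2 : ℕ) / (p.Nx : ℝ)

/-- Full offloading `[i, 1]` to device `i`. -/
def full (i : Fin p.M) : p.Action := (i, Fin.last p.Nx)

/-- Number of local CPU cycles `(1 - x) C N`. -/
def cycles (x : ℝ) : ℝ := (1 - x) * p.C * p.N

/-- Local execution latency `T₀`: `cycles` cycles of duration `1 / f`. -/
def localTime (x : ℝ) : ℝ := p.cycles x * (1 / p.f)

/-- Local energy consumption `E₀`: `cycles` cycles of energy `cap * f ^ 2`. -/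
def localEnergy (x : ℝ) : ℝ := p.cycles x * (p.cap * p.f ^ 2)

/-- Transmission time `Tᵢ` to a device with bandwidth `Bi`. -/
def offTime (Bi x : ℝ) : ℝ := x * p.C / Bi

/-- Transmission energy `Eᵢ` to a device with bandwidth `Bi`. -/
def offEnergy (Bi x : ℝ) : ℝ := p.P * x * p.C / Bi

/-- Total energy consumed in a slot. -/
def energy (Bi x : ℝ) : ℝ := p.localEnergy x + p.offEnergy Bi x

/-- The energy balance `b - (E₀ + Eᵢ) + ρ` at the end of a slot. -/
def balance (b ρ Bi x : ℝ) : ℝ := b - p.energy Bi x + ρ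

/-- The utility of a slot with battery level `b`, harvested energy `ρ`, bandwidth `Bi` of the
chosen device and offloading rate `x`. -/
def utility (b ρ Bi x : ℝ) : ℝ :=
  x * p.C - p.ψ * (if p.balance b ρ Bi x ≤ 0 then 1 else 0)
    - p.β * p.energy Bi x - p.μ * max (p.localTime x) (p.offTime Bi x)

end Params

/-- The environment of the IoT device. The bandwidths and the harvested energy are exogenous: their
law in a slot depends only on the previous bandwidths and the predicted harvested energy, not on the
battery or on the action. -/
structure Env (p : Params) where
  /-- feasible bandwidth vectors `(B₁, …, B_M)` -/
  bands : Finset (Fin p.M → ℝ)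
  /-- feasible predictions of the harvested energy -/
  preds : Finset ℝ
  /-- feasible battery levels -/
  levels : Finset ℝ
  /-- the feasible level at which a given energy balance is stored -/
  store : ℝ → ℝ
  /-- law of (bandwidths of this slot, energy harvested in this slot, prediction for the next
  slot), given the bandwidths of the previous slot and the prediction for this slot -/
  law : bands → preds → Measure (bands × ℝ × preds)
  bands_pos : ∀ B ∈ bands, ∀ i, 0 < B i
  store_mono : Monotone store
  store_mem : ∀ e, store e ∈ levels
  law_prob : ∀ B r, IsProbabilityMeasure (law B r)

namespace Env

variable {p : Params} (env : Env p)

/-- A system state: the bandwidths of the previous slot, the predicted harvested energy and the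
battery level. -/
abbrev State : Type := env.bands × env.preds × env.levels

/-- What the environment draws in a slot: bandwidths, harvested energy, next prediction. -/
abbrev Draw : Type := env.bands × ℝ × env.preds

/-- The utility of action `a` in state `s` when the environment draws `w`. -/
def reward (s : env.State) (a : p.Action) (w : env.Draw) : ℝ :=
  p.utility s.2.2 w.2.1 (w.1.1 a.1) (p.rate a)

/-- The next state. -/
def next (s : env.State) (a : p.Action) (w : env.Draw) : env.State :=
  (w.1, w.2.2,
    ⟨env.store (p.balance s.2.2 w.2.1 (w.1.1 a.1) (p.rate a)), env.store_mem _⟩)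

/-- The probability of action `a` under the `ε`-greedy policy with greedy action `g`. -/
def epsGreedy (p : Params) (ε : ℝ) (g a : p.Action) : ℝ :=
  (1 - ε) * (if a = g then 1 else 0) + ε / ((p.Nx + 1) * p.M)

open Classical in
/-- How often the pair `(s, a)` occurred before slot `k`. -/
def visits {Ω : Type*} (S : ℕ → Ω → env.State) (A : ℕ → Ω → p.Action)
    (k : ℕ) (ω : Ω) (s : env.State) (a : p.Action) : ℕ :=
  ((Finset.range k).filter (fun j => S j ω = s ∧ A j ω = a)).card

open Classical in
/-- `S, G, A, W, Q` are the states, greedy actions, executed actions, environment draws and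
Q-tables of a run of `ε`-greedy Q-learning with discount factor `γ`, in which the `n`-th update
(counted from `0`) of every state-action pair uses the learning rate `α n`. The initial table and
the initial state are arbitrary; ties between greedy actions are broken arbitrarily. -/
structure IsQLearning {Ω : Type*} {mΩ : MeasurableSpace Ω} (ℙ : Measure Ω) (ℱ : Filtration ℕ mΩ)
    (α : ℕ → ℝ) (γ ε : ℝ)
    (S : ℕ → Ω → env.State) (G A : ℕ → Ω → p.Action) (W : ℕ → Ω → env.Draw)
    (Q : ℕ → Ω → env.State → p.Action → ℝ) : Prop where
  measurable_S : Measurable[ℱ 0] (S 0)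
  measurable_Q : ∀ s a, Measurable[ℱ 0] (fun ω => Q 0 ω s a)
  measurable_G : ∀ k, Measurable[ℱ k] (G k)
  measurable_A : ∀ k, Measurable[ℱ (k + 1)] (A k)
  measurable_W : ∀ k, Measurable[ℱ (k + 1)] (W k)
  greedy : ∀ k ω a, Q k ω (S k ω) a ≤ Q k ω (S k ω) (G k ω)
  /-- given the past, the action is `ε`-greedy and the draw follows the law of the environment,
  independently of each other -/
  cond_law : ∀ (k : ℕ) (a : p.Action) (D : Set env.Draw), MeasurableSet D →
    ℙ[Set.indicator {ω | A k ω = a ∧ W k ω ∈ D} (fun _ => (1 : ℝ)) | ℱ k] =ᵐ[ℙ]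
      fun ω => epsGreedy p ε (G k ω) a * (env.law (S k ω).1 (S k ω).2.1).real D
  step_S : ∀ k ω, S (k + 1) ω = env.next (S k ω) (A k ω) (W k ω)
  step_Q : ∀ k ω s a, Q (k + 1) ω s a =
    if S k ω = s ∧ A k ω = a then
      (1 - α (env.visits S A k ω s a)) * Q k ω s a
        + α (env.visits S A k ω s a)
          * (env.reward s a (W k ω) + γ * ⨆ a', Q k ω (S (k + 1) ω) a')
    else Q k ω s a

end Env

end MEC

end

/-!
Full offloading to the device `i₀` of largest bandwidth uses no more energy than any other action in
any slot, and it loses no utility: moving a bit from local to remote computation gains at least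
`1 + β ς N f² - (μ + β P) / B ≥ 0`, and a larger bandwidth saves both time and energy
(`utility_add_le`). It therefore dominates every action twice: pointwise in the reward and, as the
battery is stored monotonically, pointwise in the next battery level. The value `V` of always
offloading fully is nondecreasing in the battery level (`IsFullValue.mono`), so `V` solves the
Bellman optimality equation (`IsFullValue.eq_iSup`). As both parts of the domination are pointwise,
an action that ties with full offloading in expected value has the same reward for almost every
draw of the environment (`reward_eq_full_ae`).

Convergence of Q-learning to the optimal values is proved path by path. The error of a table entry
is averaged with a noise term and with `γ` times the error at the next state (`step_error`). The
noise is measured against the fixed function `V` and not against the current table, so it is a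
bounded function of the draw with conditional mean zero. Weighted by the learning rates it sums to a
martingale bounded in `L²`, which converges almost surely (`ae_exists_tendsto_noise`); no
integrability of the initial table is needed. By the conditional Borel-Cantelli lemma every action
is taken infinitely often in every state that recurs (`ae_frequently_visit`). On a path with these two
properties, subtracting the tail of the noise series leaves an averaging recursion, and an eventual
bound `D` on the errors in recurrent states improves to `γ D + δ` (`eventually_error_le`); hence the
errors tend to zero. States that do not recur are eventually left for good and play no role, so
that greedy actions are eventually optimal, and optimal actions earn the reward of full offloading.
-/

namespace MEC

/-! ### Single-slot optimality of full offloading -/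

namespace Params

variable (p : Params)

/-- Full offloading with the largest bandwidth `B₀` needs the least energy: sending a bit then costs
no more than computing it locally. -/
theorem energy_full_le {B₀ Bi x : ℝ} (hBi : 0 < Bi) (hle : Bi ≤ B₀)
    (hcond : p.P / (p.cap * p.N * p.f ^ 2) ≤ B₀) (hx : x ∈ Set.Icc (0 : ℝ) 1) :
    p.energy B₀ 1 ≤ p.energy Bi x := by
  have := p.C_pos; have := p.N_pos; have := p.f_pos; have := p.cap_pos; have := p.P_pos
  have hB₀ : 0 < B₀ := hBi.trans_le hle
  have h1 : p.P / B₀ ≤ p.cap * p.N * p.f ^ 2 := by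
    rw [div_le_iff₀ (by positivity)] at hcond ⊢
    linarith
  have h2 : p.P / B₀ ≤ p.P / Bi := by gcongr
  have h3 := mul_le_mul_of_nonneg_left h1
    (mul_nonneg (sub_nonneg.2 hx.2) p.C_pos.le)
  have h4 := mul_le_mul_of_nonneg_left h2 (mul_nonneg hx.1 p.C_pos.le)
  simp only [energy, localEnergy, cycles, offEnergy]
  have e1 : p.P * 1 * p.C / B₀ = p.C * (p.P / B₀) := by ring
  have e2 : p.P * x * p.C / Bi = x * p.C * (p.P / Bi) := by ring
  rw [e1, e2]
  nlinarith

/-- The loss in utility of `[i, x]` against full offloading is at least the sum of a term due to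
the bits computed locally and a term due to the smaller bandwidth. -/
theorem utility_add_le {b b' B₀ Bi x : ℝ} (ρ : ℝ) (hb : b ≤ b') (hBi : 0 < Bi) (hle : Bi ≤ B₀)
    (hcond : p.P / (p.cap * p.N * p.f ^ 2) ≤ B₀) (hx : x ∈ Set.Icc (0 : ℝ) 1) :
    p.utility b ρ Bi x
        + ((1 - x) * p.C * (1 + p.β * p.cap * p.N * p.f ^ 2 - (p.μ + p.β * p.P) / B₀)
          + (p.μ + p.β * p.P) * x * p.C * (1 / Bi - 1 / B₀))
      ≤ p.utility b' ρ B₀ 1 := by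
  have := p.C_pos
  have hB₀ : 0 < B₀ := hBi.trans_le hle
  have hbal : p.balance b ρ Bi x ≤ p.balance b' ρ B₀ 1 := by
    have := p.energy_full_le hBi hle hcond hx
    simp only [balance]; linarith
  have hind : p.ψ * (if p.balance b' ρ B₀ 1 ≤ 0 then (1 : ℝ) else 0)
      ≤ p.ψ * (if p.balance b ρ Bi x ≤ 0 then 1 else 0) := by
    refine mul_le_mul_of_nonneg_left ?_ p.ψ_nonneg
    split_ifs with h1 h2 <;> linarith
  have hmax : p.μ * p.offTime Bi x ≤ p.μ * max (p.localTime x) (p.offTime Bi x) :=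
    mul_le_mul_of_nonneg_left (le_max_right _ _) p.μ_nonneg
  have hmax₀ : max (p.localTime 1) (p.offTime B₀ 1) = p.C / B₀ := by
    have : 0 ≤ p.C / B₀ := by positivity
    simpa [localTime, cycles, offTime] using this
  simp only [utility]
  rw [hmax₀]
  simp only [energy, localEnergy, cycles, offEnergy, offTime] at hmax ⊢
  have e : (1 - x) * p.C * (1 + p.β * p.cap * p.N * p.f ^ 2 - (p.μ + p.β * p.P) / B₀)
          + (p.μ + p.β * p.P) * x * p.C * (1 / Bi - 1 / B₀) =
      (1 - x) * p.C + p.β * ((1 - x) * p.C * p.N * (p.cap * p.f ^ 2)) - p.μ * (p.C / B₀)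
        - p.β * (p.P * p.C / B₀) + p.μ * (x * p.C / Bi) + p.β * (p.P * x * p.C / Bi) := by
    field_simp; ring
  have e' : p.P * 1 * p.C / B₀ = p.P * p.C / B₀ := by ring
  rw [e, e']
  nlinarith

theorem local_gain_nonneg {B₀ : ℝ} (hB₀ : 0 < B₀)
    (h : (p.μ + p.β * p.P) / (p.β * p.cap * p.N * p.f ^ 2 + 1) ≤ B₀) :
    0 ≤ 1 + p.β * p.cap * p.N * p.f ^ 2 - (p.μ + p.β * p.P) / B₀ := by
  have := p.N_pos; have := p.f_pos; have := p.cap_pos; have := p.β_nonneg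
  rw [div_le_iff₀ (by positivity)] at h
  rw [sub_nonneg, div_le_iff₀ hB₀]
  linarith

theorem local_gain_pos {B₀ : ℝ} (hB₀ : 0 < B₀)
    (h : (p.μ + p.β * p.P) / (p.β * p.cap * p.N * p.f ^ 2 + 1) < B₀) :
    0 < 1 + p.β * p.cap * p.N * p.f ^ 2 - (p.μ + p.β * p.P) / B₀ := by
  have := p.N_pos; have := p.f_pos; have := p.cap_pos; have := p.β_nonneg
  rw [div_lt_iff₀ (by positivity)] at h
  rw [sub_pos, div_lt_iff₀ hB₀]
  linarith

theorem bandwidth_gain_nonneg {B₀ Bi x : ℝ} (hBi : 0 < Bi) (hle : Bi ≤ B₀) (hx : 0 ≤ x) :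
    0 ≤ (p.μ + p.β * p.P) * x * p.C * (1 / Bi - 1 / B₀) := by
  have := p.C_pos; have := p.P_pos; have := p.β_nonneg; have := p.μ_nonneg
  have : 1 / B₀ ≤ 1 / Bi := by gcongr
  have := sub_nonneg.2 this
  positivity

theorem utility_le_full {b b' B₀ Bi x : ℝ} (ρ : ℝ) (hb : b ≤ b') (hBi : 0 < Bi) (hle : Bi ≤ B₀)
    (hcond : max ((p.μ + p.β * p.P) / (p.β * p.cap * p.N * p.f ^ 2 + 1))
        (p.P / (p.cap * p.N * p.f ^ 2)) ≤ B₀) (hx : x ∈ Set.Icc (0 : ℝ) 1) :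
    p.utility b ρ Bi x ≤ p.utility b' ρ B₀ 1 := by
  have h1 := p.utility_add_le ρ hb hBi hle ((le_max_right _ _).trans hcond) hx
  have h2 := mul_nonneg (mul_nonneg (sub_nonneg.2 hx.2) p.C_pos.le)
    (p.local_gain_nonneg (hBi.trans_le hle) ((le_max_left _ _).trans hcond))
  have h3 := p.bandwidth_gain_nonneg hBi hle hx.1
  linarith

theorem utility_full (b ρ : ℝ) {B₀ : ℝ} (hB₀ : 0 < B₀) :
    p.utility b ρ B₀ 1 = p.C * ((B₀ - p.β * p.P - p.μ) / B₀)
        - p.ψ * (if b - p.P * p.C / B₀ + ρ ≤ 0 then 1 else 0) := by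
  have := p.C_pos
  have hmax₀ : max (p.localTime 1) (p.offTime B₀ 1) = p.C / B₀ := by
    have : 0 ≤ p.C / B₀ := by positivity
    simpa [localTime, cycles, offTime] using this
  have hE : p.energy B₀ 1 = p.P * p.C / B₀ := by
    simp [energy, localEnergy, cycles, offEnergy]
  simp only [utility, balance, hmax₀, hE]
  field_simp
  ring

theorem rate_mem (a : p.Action) : p.rate a ∈ Set.Icc (0 : ℝ) 1 := by
  have h : (0 : ℝ) < p.Nx := by exact_mod_cast p.Nx_pos
  refine ⟨by unfold rate; positivity, ?_⟩
  rw [rate, div_le_one h]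
  exact_mod_cast Nat.lt_succ_iff.1 a.2.2

@[simp]
theorem rate_full (i : Fin p.M) : p.rate (p.full i) = 1 := by
  have h : (p.Nx : ℝ) ≠ 0 := by exact_mod_cast p.Nx_pos.ne'
  simp [rate, full, h]

theorem rate_lt_one {a : p.Action} (h : a.2 ≠ Fin.last p.Nx) : p.rate a < 1 := by
  have hN : (0 : ℝ) < p.Nx := by exact_mod_cast p.Nx_pos
  rw [rate, div_lt_one hN]
  exact_mod_cast Fin.val_lt_last h

/-- Without ties between the bandwidths, and if every bit computed locally loses utility, every
other action is strictly worse than full offloading. -/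
theorem utility_lt_full {B : Fin p.M → ℝ} {i₀ : Fin p.M} (b ρ : ℝ) (hB : ∀ i, 0 < B i)
    (hcond : p.P / (p.cap * p.N * p.f ^ 2) ≤ B i₀)
    (hgain : (p.μ + p.β * p.P) / (p.β * p.cap * p.N * p.f ^ 2 + 1) < B i₀)
    (hlt : ∀ i, i ≠ i₀ → B i < B i₀) (hpos : 0 < p.μ + p.β * p.P)
    {a : p.Action} (ha : a ≠ p.full i₀) :
    p.utility b ρ (B a.1) (p.rate a) < p.utility b ρ (B i₀) 1 := by
  have hC := p.C_pos
  have hle : B a.1 ≤ B i₀ := by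
    by_cases h : a.1 = i₀
    · rw [h]
    · exact (hlt _ h).le
  have h1 := p.utility_add_le ρ le_rfl (hB a.1) hle hcond (p.rate_mem a) (b := b)
  have hg := p.local_gain_pos (hB i₀) hgain
  have h3 := p.bandwidth_gain_nonneg (hB a.1) hle (p.rate_mem a).1
  by_cases hx : a.2 = Fin.last p.Nx
  · have hi : a.1 ≠ i₀ := fun h => ha (Prod.ext h hx)
    have hr : p.rate a = 1 := by
      rw [← p.rate_full a.1]; simp [rate, full, hx]
    have h4 : 0 < 1 / B a.1 - 1 / B i₀ :=
      sub_pos.2 (one_div_lt_one_div_of_lt (hB _) (hlt _ hi))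
    have h5 : 0 < (p.μ + p.β * p.P) * 1 * p.C * (1 / B a.1 - 1 / B i₀) := by positivity
    rw [hr] at h1 ⊢
    linarith
  · have h4 := mul_pos (mul_pos (sub_pos.2 (p.rate_lt_one hx)) hC) hg
    linarith

end Params

end MEC

/-! ### Averaging recursions and counting -/

/-- A sequence that is repeatedly averaged, with weights of divergent sum, with values that
eventually lie in `[-c, c]`, is itself eventually almost in `[-c, c]`. -/
theorem eventually_abs_le_of_averaging {a X e : ℕ → ℝ} (ha : ∀ t, 0 ≤ a t ∧ a t ≤ 1)
    (hs : ¬ Summable a) (hX : ∀ t, X (t + 1) = (1 - a t) * X t + a t * e t) {c : ℝ}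
    (hc : ∀ᶠ t in atTop, |e t| ≤ c) {δ : ℝ} (hδ : 0 < δ) :
    ∀ᶠ t in atTop, |X t| ≤ c + δ := by
  obtain ⟨T, hT⟩ := eventually_atTop.1 hc
  set K := max (|X T| - c) 0 with hK
  -- the excess over `c` is at most multiplied by `1 - a ≤ exp (-a)` in every step
  have key : ∀ n, |X (T + n)| - c ≤ K * Real.exp (-∑ j ∈ Finset.range n, a (T + j)) := by
    intro n
    induction n with
    | zero => simp [hK]
    | succ n ih =>
      obtain ⟨h0, h1⟩ := ha (T + n)
      have hstep : |X (T + n + 1)| ≤ (1 - a (T + n)) * |X (T + n)| + a (T + n) * c := by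
        rw [hX]
        refine (abs_add_le _ _).trans ?_
        rw [abs_mul, abs_mul, abs_of_nonneg h0, abs_of_nonneg (sub_nonneg.2 h1)]
        gcongr
        exact hT _ (Nat.le_add_right _ _)
      have hexp : 1 - a (T + n) ≤ Real.exp (-a (T + n)) := by
        have := Real.add_one_le_exp (-a (T + n)); linarith
      rw [Finset.sum_range_succ, neg_add, Real.exp_add, ← add_assoc]
      have hKE : 0 ≤ K * Real.exp (-∑ j ∈ Finset.range n, a (T + j)) :=
        mul_nonneg (le_max_right _ _) (Real.exp_pos _).le
      calc |X (T + n + 1)| - c ≤ (1 - a (T + n)) * (|X (T + n)| - c) := by linarith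
        _ ≤ (1 - a (T + n)) * (K * Real.exp (-∑ j ∈ Finset.range n, a (T + j))) :=
            mul_le_mul_of_nonneg_left ih (sub_nonneg.2 h1)
        _ ≤ Real.exp (-a (T + n)) * (K * Real.exp (-∑ j ∈ Finset.range n, a (T + j))) :=
            mul_le_mul_of_nonneg_right hexp hKE
        _ = _ := by ring
  have hs' : ¬ Summable (fun j => a (T + j)) := by
    have := summable_nat_add_iff (f := a) T
    simpa only [add_comm T] using this.not.2 hs
  have hdiv := (not_summable_iff_tendsto_nat_atTop_of_nonneg (fun j => (ha (T + j)).1)).1 hs'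
  have hlim : Tendsto (fun n => K * Real.exp (-∑ j ∈ Finset.range n, a (T + j))) atTop (𝓝 0) := by
    simpa using (Real.tendsto_exp_neg_atTop_nhds_zero.comp hdiv).const_mul K
  obtain ⟨n₀, hn₀⟩ := eventually_atTop.1 (hlim.eventually (gt_mem_nhds hδ))
  refine eventually_atTop.2 ⟨T + n₀, fun t ht => ?_⟩
  obtain ⟨n, rfl⟩ := Nat.exists_eq_add_of_le ((Nat.le_add_right T n₀).trans ht)
  have h1 := key n
  have h2 := hn₀ n (by omega)
  linarith

theorem sum_range_ite_count {p : ℕ → Prop} [DecidablePred p] (f : ℕ → ℝ) (t : ℕ) :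
    ∑ j ∈ Finset.range t, (if p j then f (Nat.count p j) else 0)
      = ∑ n ∈ Finset.range (Nat.count p t), f n := by
  induction t with
  | zero => simp
  | succ t ih =>
    rw [Finset.sum_range_succ, ih, Nat.count_succ]
    split_ifs with h
    · rw [Finset.sum_range_succ]
    · simp

theorem not_summable_ite_count {p : ℕ → Prop} [DecidablePred p] {f : ℕ → ℝ} (hf : ∀ n, 0 ≤ f n)
    (hs : ¬ Summable f) (hp : ∃ᶠ j in atTop, p j) :
    ¬ Summable (fun j => if p j then f (Nat.count p j) else 0) := by
  have h0 : ∀ j, 0 ≤ (if p j then f (Nat.count p j) else 0) := fun j => by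
    split_ifs; exacts [hf _, le_rfl]
  rw [not_summable_iff_tendsto_nat_atTop_of_nonneg h0]
  simp_rw [sum_range_ite_count]
  refine ((not_summable_iff_tendsto_nat_atTop_of_nonneg hf).1 hs).comp ?_
  refine tendsto_atTop_atTop.2 fun b => ?_
  have hinf : (Set.ofPred p).Infinite := Nat.frequently_atTop_iff_infinite.1 hp
  refine ⟨Nat.nth p b, fun t ht => ?_⟩
  calc b = Nat.count p (Nat.nth p b) := (Nat.count_nth_of_infinite hinf b).symm
    _ ≤ Nat.count p t := Nat.count_monotone p ht

/-! ### Values of state-action pairs -/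

namespace MEC

theorem integrable_of_finite_range {X : Type*} [MeasurableSpace X] {ν : Measure X}
    [IsFiniteMeasure ν] {h : X → ℝ} (hm : Measurable h) (hf : (Set.range h).Finite) :
    Integrable h ν := by
  obtain ⟨R, hR⟩ := (hf.image abs).bddAbove
  exact .of_bound hm.aestronglyMeasurable R (ae_of_all _ fun w => hR ⟨_, ⟨w, rfl⟩, rfl⟩)

namespace Env

variable {p : Params} (env : Env p)

theorem measurable_balance (s : env.State) (a : p.Action) :
    Measurable fun w : env.Draw => p.balance s.2.2 w.2.1 (w.1.1 a.1) (p.rate a) := by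
  have h : Measurable fun w : env.Draw => p.energy (w.1.1 a.1) (p.rate a) :=
    (measurable_of_finite fun B : env.bands => p.energy (B.1 a.1) (p.rate a)).comp measurable_fst
  exact (measurable_const.sub h).add measurable_snd.fst

theorem measurable_next (s : env.State) (a : p.Action) : Measurable (env.next s a) :=
  measurable_fst.prodMk (measurable_snd.snd.prodMk
    ((env.store_mono.measurable.comp (env.measurable_balance s a)).subtype_mk))

theorem measurable_reward (s : env.State) (a : p.Action) : Measurable (env.reward s a) := by
  have h (F : env.bands → ℝ) : Measurable fun w : env.Draw => F w.1 :=
    (measurable_of_finite F).comp measurable_fst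
  have hind : Measurable fun w : env.Draw =>
      if p.balance s.2.2 w.2.1 (w.1.1 a.1) (p.rate a) ≤ 0 then (1 : ℝ) else 0 :=
    Measurable.ite (measurableSet_le (env.measurable_balance s a) measurable_const)
      measurable_const measurable_const
  exact ((measurable_const.sub (hind.const_mul p.ψ)).sub
    (h fun B => p.β * p.energy (B.1 a.1) (p.rate a))).sub
    (h fun B => p.μ * max (p.localTime (p.rate a)) (p.offTime (B.1 a.1) (p.rate a)))

/-- The reward depends on the harvested energy only through the sign of the energy balance. -/
theorem finite_range_reward (s : env.State) (a : p.Action) :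
    (Set.range (env.reward s a)).Finite := by
  refine (Set.finite_range fun q : env.bands × ({0, 1} : Finset ℝ) =>
    p.rate a * p.C - p.ψ * q.2 - p.β * p.energy (q.1.1 a.1) (p.rate a)
      - p.μ * max (p.localTime (p.rate a)) (p.offTime (q.1.1 a.1) (p.rate a))).subset ?_
  rintro _ ⟨w, rfl⟩
  exact ⟨(w.1, ⟨if p.balance s.2.2 w.2.1 (w.1.1 a.1) (p.rate a) ≤ 0 then 1 else 0,
    by split_ifs <;> simp⟩), rfl⟩

theorem exists_abs_reward_le : ∃ R, ∀ s a w, |env.reward s a w| ≤ R := by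
  have h (q : env.State × p.Action) : ∃ R, ∀ w, |env.reward q.1 q.2 w| ≤ R := by
    obtain ⟨R, hR⟩ := ((env.finite_range_reward q.1 q.2).image abs).bddAbove
    exact ⟨R, fun w => hR ⟨_, ⟨w, rfl⟩, rfl⟩⟩
  choose R hR using h
  refine ⟨∑ q, |R q|, fun s a w => ?_⟩
  exact (hR (s, a) w).trans ((le_abs_self _).trans
    (Finset.single_le_sum (f := fun q => |R q|) (fun _ _ => abs_nonneg _) (Finset.mem_univ (s, a))))

/-- Reward plus discounted value, under `V`, of the next state. -/
noncomputable def backup (γ : ℝ) (V : env.State → ℝ) (s : env.State) (a : p.Action) (w : env.Draw) :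
    ℝ :=
  env.reward s a w + γ * V (env.next s a w)

/-- Expected reward plus discounted value, under `V`, of the next state. -/
noncomputable def actionValue (γ : ℝ) (V : env.State → ℝ) (s : env.State) (a : p.Action) : ℝ :=
  ∫ w, env.backup γ V s a w ∂env.law s.1 s.2.1

theorem measurable_backup (γ : ℝ) (V : env.State → ℝ) (s : env.State) (a : p.Action) :
    Measurable (env.backup γ V s a) :=
  (env.measurable_reward s a).add
    (((measurable_of_finite V).comp (env.measurable_next s a)).const_mul γ)

theorem finite_range_backup (γ : ℝ) (V : env.State → ℝ) (s : env.State) (a : p.Action) :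
    (Set.range (env.backup γ V s a)).Finite := by
  refine ((env.finite_range_reward s a).image2 (fun r v => r + γ * v)
    (Set.finite_range V)).subset ?_
  rintro _ ⟨w, rfl⟩
  exact ⟨_, ⟨w, rfl⟩, _, ⟨env.next s a w, rfl⟩, rfl⟩

theorem integrable_backup (γ : ℝ) (V : env.State → ℝ) (s : env.State) (a : p.Action) :
    Integrable (env.backup γ V s a) (env.law s.1 s.2.1) :=
  have := env.law_prob s.1 s.2.1
  integrable_of_finite_range (env.measurable_backup γ V s a) (env.finite_range_backup γ V s a)

/-- `V` is the discounted value of the policy that always offloads everything to `i₀`. -/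
def IsFullValue (γ : ℝ) (i₀ : Fin p.M) (V : env.State → ℝ) : Prop :=
  ∀ s, V s = env.actionValue γ V s (p.full i₀)

theorem exists_isFullValue {γ : ℝ} (hγ : 0 ≤ γ) (hγ1 : γ < 1) (i₀ : Fin p.M) :
    ∃ V, env.IsFullValue γ i₀ V := by
  have hc : ContractingWith ⟨γ, hγ⟩ (fun (V : env.State → ℝ) s =>
      env.actionValue γ V s (p.full i₀)) := by
    refine ⟨by exact_mod_cast hγ1, LipschitzWith.of_dist_le_mul fun V V' => ?_⟩
    refine (dist_pi_le_iff (by positivity)).2 fun s => ?_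
    have := env.law_prob s.1 s.2.1
    rw [Real.dist_eq, actionValue, actionValue, ← integral_sub (env.integrable_backup _ _ _ _)
      (env.integrable_backup _ _ _ _)]
    have hw (w : env.Draw) : ‖env.backup γ V s (p.full i₀) w - env.backup γ V' s (p.full i₀) w‖
        ≤ γ * dist V V' := by
      rw [backup, backup, add_sub_add_left_eq_sub, ← mul_sub, norm_mul, Real.norm_eq_abs,
        abs_of_nonneg hγ]
      exact mul_le_mul_of_nonneg_left (dist_le_pi_dist V V' _) hγ
    have h := norm_integral_le_of_norm_le_const (μ := env.law s.1 s.2.1) (ae_of_all _ hw)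
    rwa [probReal_univ, mul_one] at h
  exact ⟨hc.fixedPoint, fun s => (congrFun hc.fixedPoint_isFixedPt s).symm⟩

/-! ### Optimality of full offloading -/

section Dominance

variable {env} {i₀ : Fin p.M} {γ : ℝ} {V : env.State → ℝ}

variable (hmax : ∀ B ∈ env.bands, ∀ i, B i ≤ B i₀)
  (hcond : ∀ B ∈ env.bands,
      max ((p.μ + p.β * p.P) / (p.β * p.cap * p.N * p.f ^ 2 + 1))
        (p.P / (p.cap * p.N * p.f ^ 2)) ≤ B i₀)

include hmax hcond

theorem reward_le_full (B : env.bands) (r : env.preds) {b b' : env.levels} (hb : b ≤ b')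
    (a : p.Action) (w : env.Draw) :
    env.reward (B, r, b) a w ≤ env.reward (B, r, b') (p.full i₀) w := by
  have h := p.utility_le_full w.2.1 (b := b) (b' := b') hb (env.bands_pos _ w.1.2 a.1)
    (hmax _ w.1.2 a.1) (hcond _ w.1.2) (p.rate_mem a)
  rw [reward, reward, p.rate_full]
  exact h

theorem next_le_full (B : env.bands) (r : env.preds) {b b' : env.levels} (hb : b ≤ b')
    (a : p.Action) (w : env.Draw) :
    (env.next (B, r, b) a w).2.2 ≤ (env.next (B, r, b') (p.full i₀) w).2.2 := by
  refine env.store_mono ?_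
  have h := p.energy_full_le (env.bands_pos _ w.1.2 a.1) (hmax _ w.1.2 a.1)
    ((le_max_right _ _).trans (hcond _ w.1.2)) (p.rate_mem a)
  have hb' : (b : ℝ) ≤ b' := hb
  simp only [Params.balance, p.rate_full]
  simp only [Params.full]
  linarith

/-- The value of full offloading is nondecreasing in the battery level: the largest drop between
comparable levels is at most `γ` times itself. -/
theorem IsFullValue.mono (hγ : 0 ≤ γ) (hγ1 : γ < 1) (hV : env.IsFullValue γ i₀ V)
    (B : env.bands) (r : env.preds) {b b' : env.levels} (hb : b ≤ b') :
    V (B, r, b) ≤ V (B, r, b') := by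
  let T := {q : env.bands × env.preds × env.levels × env.levels // q.2.2.1 ≤ q.2.2.2}
  have : Nonempty T := ⟨⟨(B, r, b, b'), hb⟩⟩
  obtain ⟨⟨⟨B₁, r₁, b₁, b₁'⟩, hb₁⟩, hq⟩ := Finite.exists_max fun q : T =>
    V (q.1.1, q.1.2.1, q.1.2.2.1) - V (q.1.1, q.1.2.1, q.1.2.2.2)
  dsimp only at hb₁ hq
  set δ := V (B₁, r₁, b₁) - V (B₁, r₁, b₁') with hδ
  have hdrop {B r} {b b' : env.levels} (h : b ≤ b') : V (B, r, b) - V (B, r, b') ≤ δ :=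
    hq ⟨(B, r, b, b'), h⟩
  have hδγ : δ ≤ γ * δ := by
    have := env.law_prob B₁ r₁
    have hδ' := hδ
    rw [hV (B₁, r₁, b₁), hV (B₁, r₁, b₁'), actionValue, actionValue,
      ← integral_sub (env.integrable_backup γ V (B₁, r₁, b₁) _)
        (env.integrable_backup γ V (B₁, r₁, b₁') _)] at hδ'
    calc δ = _ := hδ'
      _ ≤ ∫ _, γ * δ ∂env.law B₁ r₁ := by
          refine integral_mono ((env.integrable_backup γ V (B₁, r₁, b₁) _).sub
            (env.integrable_backup γ V (B₁, r₁, b₁') _)) (integrable_const _) fun w => ?_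
          have h1 := reward_le_full hmax hcond B₁ r₁ hb₁ (p.full i₀) w
          have h2 := mul_le_mul_of_nonneg_left
            (hdrop (B := w.1) (r := w.2.2) (next_le_full hmax hcond B₁ r₁ hb₁ (p.full i₀) w)) hγ
          rw [mul_sub] at h2
          have e (b : env.levels) : env.next (B₁, r₁, b) (p.full i₀) w
            = (w.1, w.2.2, (env.next (B₁, r₁, b) (p.full i₀) w).2.2) := rfl
          rw [← e, ← e] at h2
          simp only [backup]
          linarith
      _ = γ * δ := by simp
  have := hdrop hb (B := B) (r := r)
  nlinarith

theorem backup_le_full (hγ : 0 ≤ γ) (hγ1 : γ < 1) (hV : env.IsFullValue γ i₀ V)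
    (s : env.State) (a : p.Action) (w : env.Draw) :
    env.backup γ V s a w ≤ env.backup γ V s (p.full i₀) w :=
  add_le_add (reward_le_full hmax hcond s.1 s.2.1 le_rfl a w)
    (mul_le_mul_of_nonneg_left (hV.mono hmax hcond hγ hγ1 w.1 w.2.2
      (next_le_full hmax hcond s.1 s.2.1 le_rfl a w)) hγ)

theorem actionValue_le_full (hγ : 0 ≤ γ) (hγ1 : γ < 1) (hV : env.IsFullValue γ i₀ V)
    (s : env.State) (a : p.Action) :
    env.actionValue γ V s a ≤ env.actionValue γ V s (p.full i₀) :=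
  integral_mono (env.integrable_backup _ _ _ _) (env.integrable_backup _ _ _ _)
    (backup_le_full hmax hcond hγ hγ1 hV s a)

/-- `V` solves the Bellman optimality equation. -/
theorem IsFullValue.eq_iSup (hγ : 0 ≤ γ) (hγ1 : γ < 1) (hV : env.IsFullValue γ i₀ V)
    (s : env.State) : V s = ⨆ a, env.actionValue γ V s a := by
  have : Nonempty p.Action := ⟨p.full i₀⟩
  rw [hV s]
  exact le_antisymm (le_ciSup (Finite.bddAbove_range _) (p.full i₀))
    (ciSup_le (actionValue_le_full hmax hcond hγ hγ1 hV s))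

/-- An action that is as good as full offloading in expectation is almost surely as good: both the
reward and the next battery level are pointwise dominated by those of full offloading. -/
theorem reward_eq_full_ae (hγ : 0 ≤ γ) (hγ1 : γ < 1) (hV : env.IsFullValue γ i₀ V)
    {s : env.State} {a : p.Action}
    (h : env.actionValue γ V s a = env.actionValue γ V s (p.full i₀)) :
    ∀ᵐ w ∂env.law s.1 s.2.1, env.reward s a w = env.reward s (p.full i₀) w := by
  have h0 : ∫ w, (env.backup γ V s (p.full i₀) w - env.backup γ V s a w)
      ∂env.law s.1 s.2.1 = 0 := by
    rw [integral_sub (env.integrable_backup _ _ _ _) (env.integrable_backup _ _ _ _)]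
    exact sub_eq_zero.2 h.symm
  rw [integral_eq_zero_iff_of_nonneg
    (fun w => sub_nonneg.2 (backup_le_full hmax hcond hγ hγ1 hV s a w))
    ((env.integrable_backup _ _ _ _).sub (env.integrable_backup _ _ _ _))] at h0
  filter_upwards [h0] with w hw
  have h1 := reward_le_full hmax hcond s.1 s.2.1 le_rfl (b := s.2.2) a w
  have h2 := mul_le_mul_of_nonneg_left (hV.mono hmax hcond hγ hγ1 w.1 w.2.2
      (next_le_full hmax hcond s.1 s.2.1 (le_refl s.2.2) a w)) hγ
  have h3 : env.backup γ V s (p.full i₀) w - env.backup γ V s a w = 0 := hw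
  refine le_antisymm h1 ?_
  have e : env.reward s (p.full i₀) w + γ * V (env.next s (p.full i₀) w)
    - (env.reward s a w + γ * V (env.next s a w)) = 0 := h3
  have h2' : γ * V (env.next s a w) ≤ γ * V (env.next s (p.full i₀) w) := h2
  change env.reward s (p.full i₀) w ≤ env.reward s a w
  linarith

end Dominance

end Env

end MEC

/-! ### Martingales with summable squared increments -/

/-- Bounded martingale differences whose squares have uniformly bounded partial sums are almost
surely summable: their partial sums form a martingale that is bounded in `L²`. -/
theorem MeasureTheory.ae_exists_tendsto_sum_of_condExp_eq_zero {Ω : Type*} {mΩ : MeasurableSpace Ω}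
    {ℙ : Measure Ω} [IsProbabilityMeasure ℙ] {ℱ : Filtration ℕ mΩ} {d : ℕ → Ω → ℝ} {K R : ℝ}
    (hmeas : ∀ n, StronglyMeasurable[ℱ (n + 1)] (d n)) (hK : ∀ n ω, |d n ω| ≤ K)
    (hzero : ∀ n, ℙ[d n | ℱ n] =ᵐ[ℙ] 0) (hR : ∀ n ω, ∑ j ∈ Finset.range n, d j ω ^ 2 ≤ R) :
    ∀ᵐ ω ∂ℙ, ∃ c, Tendsto (fun n => ∑ j ∈ Finset.range n, d j ω) atTop (𝓝 c) := by
  let M : ℕ → Ω → ℝ := fun n ω => ∑ j ∈ Finset.range n, d j ω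
  have hMs (n : ℕ) : M (n + 1) = M n + d n := by
    ext ω; exact Finset.sum_range_succ _ _
  have hM (n : ℕ) : StronglyMeasurable[ℱ n] (M n) :=
    Finset.stronglyMeasurable_fun_sum _ fun j hj =>
      (hmeas j).mono (ℱ.mono (Finset.mem_range.1 hj))
  have hM' (n : ℕ) : StronglyMeasurable (M n) := (hM n).mono (ℱ.le n)
  have hd' (n : ℕ) : StronglyMeasurable (d n) := (hmeas n).mono (ℱ.le _)
  have hMb (n : ℕ) (ω : Ω) : |M n ω| ≤ n * K := by
    refine (Finset.abs_sum_le_sum_abs _ _).trans ((Finset.sum_le_sum fun j _ => hK j ω).trans ?_)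
    simp
  have int_of_bound {g : Ω → ℝ} {c : ℝ} (hg : StronglyMeasurable g) (hc : ∀ ω, |g ω| ≤ c) :
      Integrable g ℙ := .of_bound hg.aestronglyMeasurable c (ae_of_all _ hc)
  have hdi (n : ℕ) : Integrable (d n) ℙ := int_of_bound (hd' n) (hK n)
  have hMi (n : ℕ) : Integrable (M n) ℙ := int_of_bound (hM' n) (hMb n)
  have hMdi (n : ℕ) : Integrable (M n * d n) ℙ := by
    refine int_of_bound (c := n * K * K) ((hM' n).mul (hd' n)) fun ω => ?_
    rw [Pi.mul_apply, abs_mul]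
    exact mul_le_mul (hMb n ω) (hK n ω) (abs_nonneg _) ((abs_nonneg _).trans (hMb n ω))
  have hsq {g : Ω → ℝ} {c : ℝ} (hg : StronglyMeasurable g) (hc : ∀ ω, |g ω| ≤ c) :
      Integrable (fun ω => g ω ^ 2) ℙ := by
    refine int_of_bound (c := c ^ 2) (hg.pow 2) fun ω => ?_
    rw [abs_pow]
    exact pow_le_pow_left₀ (abs_nonneg _) (hc ω) 2
  have hdsq (n : ℕ) := hsq (hd' n) (hK n)
  have hMsq (n : ℕ) := hsq (hM' n) (hMb n)
  have horth (n : ℕ) : ∫ ω, (M n * d n) ω ∂ℙ = 0 := by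
    rw [← integral_condExp (ℱ.le n)]
    refine integral_eq_zero_of_ae ?_
    filter_upwards [condExp_mul_of_stronglyMeasurable_left (hM n) (hMdi n) (hdi n), hzero n]
      with ω h1 h2
    rw [h1, Pi.mul_apply, h2, Pi.zero_apply, mul_zero]
  have hL2 (n : ℕ) : ∫ ω, M n ω ^ 2 ∂ℙ = ∫ ω, ∑ j ∈ Finset.range n, d j ω ^ 2 ∂ℙ := by
    induction n with
    | zero => simp [M]
    | succ n ih =>
      have e : (fun ω => M (n + 1) ω ^ 2)
          = fun ω => M n ω ^ 2 + 2 * (M n * d n) ω + d n ω ^ 2 := by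
        ext ω; rw [hMs, Pi.add_apply, Pi.mul_apply]; ring
      simp_rw [Finset.sum_range_succ]
      have h1 : Integrable (fun ω => M n ω ^ 2 + 2 * (M n * d n) ω) ℙ :=
        (hMsq n).add ((hMdi n).const_mul 2)
      rw [e, integral_add h1 (hdsq n),
        integral_add (hMsq n) ((hMdi n).const_mul 2), integral_const_mul, horth, ih,
        integral_add (integrable_finsetSum _ fun j _ => hdsq j) (hdsq n)]
      ring
  have hmart : Martingale M ℱ ℙ := by
    refine martingale_of_condExp_sub_eq_zero_nat hM hMi fun n => ?_
    rw [hMs, add_sub_cancel_left]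
    exact hzero n
  refine hmart.submartingale.exists_ae_tendsto_of_bdd (R := (1 + R).toNNReal) fun n => ?_
  rw [eLpNorm_one_eq_lintegral_enorm, ← ofReal_integral_norm_eq_lintegral_enorm (hMi n)]
  refine ENNReal.ofReal_le_ofReal ?_
  calc ∫ ω, ‖M n ω‖ ∂ℙ ≤ ∫ ω, (1 + M n ω ^ 2) ∂ℙ := by
        refine integral_mono (hMi n).norm ((integrable_const _).add (hMsq n)) fun ω => ?_
        rw [Real.norm_eq_abs]
        have := sq_nonneg (|M n ω| - 1)
        have := sq_abs (M n ω)
        nlinarith [abs_nonneg (M n ω)]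
    _ = 1 + ∫ ω, ∑ j ∈ Finset.range n, d j ω ^ 2 ∂ℙ := by
        rw [integral_add (integrable_const _) (hMsq n), hL2]; simp
    _ ≤ 1 + ∫ _, R ∂ℙ := by
        have := integral_mono (integrable_finsetSum _ fun j _ => hdsq j) (integrable_const R) (hR n)
        linarith
    _ = 1 + R := by simp

namespace MEC

namespace Env

variable {p : Params} {env : Env p}

/-! ### Runs of Q-learning -/

open Classical in
/-- The learning rate with which slot `k` updates the pair `(s, a)`; it vanishes if another pair is
visited. -/
noncomputable def stepSize {Ω : Type*} (α : ℕ → ℝ) (S : ℕ → Ω → env.State)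
    (A : ℕ → Ω → p.Action) (s : env.State) (a : p.Action) (k : ℕ) (ω : Ω) : ℝ :=
  if S k ω = s ∧ A k ω = a then α (env.visits S A k ω s a) else 0

/-- The deviation of the backed-up value of `(s, a)` from its mean. -/
noncomputable def noise (env : Env p) (γ : ℝ) (V : env.State → ℝ) (s : env.State) (a : p.Action)
    (w : env.Draw) : ℝ :=
  env.backup γ V s a w - env.actionValue γ V s a

theorem measurable_noise (γ : ℝ) (V : env.State → ℝ) (s : env.State) (a : p.Action) :
    Measurable (env.noise γ V s a) :=
  (env.measurable_backup γ V s a).sub_const _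

theorem finite_range_noise (γ : ℝ) (V : env.State → ℝ) (s : env.State) (a : p.Action) :
    (Set.range (env.noise γ V s a)).Finite := by
  refine ((env.finite_range_backup γ V s a).image (· - env.actionValue γ V s a)).subset ?_
  rintro _ ⟨w, rfl⟩
  exact ⟨_, ⟨w, rfl⟩, rfl⟩

theorem integral_noise (γ : ℝ) (V : env.State → ℝ) (s : env.State) (a : p.Action) :
    ∫ w, env.noise γ V s a w ∂env.law s.1 s.2.1 = 0 := by
  have := env.law_prob s.1 s.2.1
  simp only [noise]
  rw [integral_sub (env.integrable_backup _ _ _ _) (integrable_const _)]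
  simp [actionValue]

section Steps

variable {Ω : Type*} {α : ℕ → ℝ} {S : ℕ → Ω → env.State} {A : ℕ → Ω → p.Action}

open Classical in
theorem visits_eq_count (s : env.State) (a : p.Action) (k : ℕ) (ω : Ω) :
    env.visits S A k ω s a = Nat.count (fun j => S j ω = s ∧ A j ω = a) k := by
  rw [visits, Nat.count_eq_card_filter_range]

theorem stepSize_mem (hα : ∀ n, 0 ≤ α n ∧ α n ≤ 1) (s : env.State) (a : p.Action) (k : ℕ) (ω : Ω) :
    0 ≤ stepSize α S A s a k ω ∧ stepSize α S A s a k ω ≤ 1 := by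
  unfold stepSize
  split_ifs
  exacts [hα _, ⟨le_rfl, zero_le_one⟩]

theorem sum_stepSize_sq_le (hα : Summable fun n => α n ^ 2) (s : env.State) (a : p.Action)
    (k : ℕ) (ω : Ω) :
    ∑ j ∈ Finset.range k, stepSize α S A s a j ω ^ 2 ≤ ∑' n, α n ^ 2 := by
  classical
  have h := sum_range_ite_count (p := fun j => S j ω = s ∧ A j ω = a) (fun n => α n ^ 2) k
  refine le_trans (le_of_eq ?_) (h.le.trans (hα.sum_le_tsum _ fun n _ => sq_nonneg _))
  refine Finset.sum_congr rfl fun j _ => ?_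
  rw [stepSize, visits_eq_count]
  by_cases hj : S j ω = s ∧ A j ω = a
  · rw [if_pos hj, if_pos hj]
  · rw [if_neg hj, if_neg hj]; norm_num

theorem not_summable_stepSize (hα : ∀ n, 0 ≤ α n) (hs : ¬ Summable α) {s : env.State}
    {a : p.Action} {ω : Ω} (hfreq : ∃ᶠ k in atTop, S k ω = s ∧ A k ω = a) :
    ¬ Summable fun k => stepSize α S A s a k ω := by
  classical
  convert not_summable_ite_count hα hs hfreq using 3 with k
  rw [stepSize, visits_eq_count]

end Steps

namespace IsQLearning

variable {Ω : Type*} {mΩ : MeasurableSpace Ω} {ℙ : Measure Ω} {ℱ : Filtration ℕ mΩ} {α : ℕ → ℝ}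
  {γ ε : ℝ} {S : ℕ → Ω → env.State} {G A : ℕ → Ω → p.Action} {W : ℕ → Ω → env.Draw}
  {Q : ℕ → Ω → env.State → p.Action → ℝ}

theorem measurable_state (h : env.IsQLearning ℙ ℱ α γ ε S G A W Q) (k : ℕ) :
    Measurable[ℱ k] (S k) := by
  induction k with
  | zero => exact h.measurable_S
  | succ k ih =>
    have hF : Measurable fun q : (env.State × p.Action) × env.Draw => env.next q.1.1 q.1.2 q.2 :=
      measurable_from_prod_countable_right fun q => env.measurable_next q.1 q.2
    have hS : Measurable[ℱ (k + 1)] (S k) := ih.mono (ℱ.mono k.le_succ) le_rfl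
    have := hF.comp ((hS.prodMk (h.measurable_A k)).prodMk (h.measurable_W k))
    rwa [show S (k + 1) = _ from funext (h.step_S k)]

theorem measurableSet_state (h : env.IsQLearning ℙ ℱ α γ ε S G A W Q) (k : ℕ) (s : env.State) :
    MeasurableSet[ℱ k] {ω | S k ω = s} :=
  h.measurable_state k (measurableSet_singleton s)

theorem measurableSet_action (h : env.IsQLearning ℙ ℱ α γ ε S G A W Q) (k : ℕ) (a : p.Action) :
    MeasurableSet[ℱ (k + 1)] {ω | A k ω = a} :=
  h.measurable_A k (measurableSet_singleton a)

theorem measurableSet_visit (h : env.IsQLearning ℙ ℱ α γ ε S G A W Q) (k : ℕ) (s : env.State)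
    (a : p.Action) : MeasurableSet[ℱ (k + 1)] {ω | S k ω = s ∧ A k ω = a} :=
  MeasurableSet.inter (ℱ.mono k.le_succ _ (h.measurableSet_state k s)) (h.measurableSet_action k a)

theorem measurable_visits (h : env.IsQLearning ℙ ℱ α γ ε S G A W Q) (k : ℕ) (s : env.State)
    (a : p.Action) : Measurable[ℱ k] fun ω => env.visits S A k ω s a := by
  classical
  simp only [visits, Finset.card_filter]
  refine Finset.measurable_fun_sum _ fun j hj => ?_
  refine Measurable.ite ?_ measurable_const measurable_const
  exact ℱ.mono (Finset.mem_range.1 hj) _ (h.measurableSet_visit j s a)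

/-- The conditional law of action and draw, integrated against a function of the draw. -/
theorem condExp_action_draw [IsProbabilityMeasure ℙ] (h : env.IsQLearning ℙ ℱ α γ ε S G A W Q)
    (k : ℕ) (a : p.Action) {φ : env.Draw → ℝ} (hφ : Measurable φ) (hfin : (Set.range φ).Finite) :
    ℙ[Set.indicator {ω | A k ω = a} (fun ω => φ (W k ω)) | ℱ k] =ᵐ[ℙ]
      fun ω => epsGreedy p ε (G k ω) a * ∫ w, φ w ∂env.law (S k ω).1 (S k ω).2.1 := by
  classical
  set F := hfin.toFinset
  have hdecomp (w : env.Draw) : φ w = ∑ v ∈ F, v * (φ ⁻¹' {v}).indicator (fun _ => 1) w := by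
    rw [Finset.sum_eq_single (φ w)]
    · simp
    · intro v _ hv
      rw [Set.indicator_of_notMem (by simpa using hv.symm), mul_zero]
    · intro hw
      exact absurd (hfin.mem_toFinset.2 ⟨w, rfl⟩) hw
  have hD (v : ℝ) : MeasurableSet (φ ⁻¹' {v}) := hφ (measurableSet_singleton v)
  have hint (ω : Ω) : ∫ w, φ w ∂env.law (S k ω).1 (S k ω).2.1
      = ∑ v ∈ F, v * (env.law (S k ω).1 (S k ω).2.1).real (φ ⁻¹' {v}) := by
    have := env.law_prob (S k ω).1 (S k ω).2.1
    conv_lhs => enter [2, w]; rw [hdecomp w]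
    rw [integral_finsetSum _ fun v _ =>
      ((integrable_const (1 : ℝ)).indicator (hD v)).const_mul v]
    refine Finset.sum_congr rfl fun v _ => ?_
    rw [integral_const_mul, integral_indicator_const _ (hD v), smul_eq_mul, mul_one]
  have hfun : Set.indicator {ω | A k ω = a} (fun ω => φ (W k ω)) = ∑ v ∈ F,
      v • Set.indicator {ω | A k ω = a ∧ W k ω ∈ φ ⁻¹' {v}} (fun _ => (1 : ℝ)) := by
    ext ω
    rw [Finset.sum_apply]
    by_cases hω : A k ω = a
    · rw [Set.indicator_of_mem (by exact hω), hdecomp]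
      refine Finset.sum_congr rfl fun v _ => ?_
      by_cases hv : φ (W k ω) = v <;> simp [hω, hv]
    · simp [hω]
  have hmeas (v : ℝ) : MeasurableSet {ω | A k ω = a ∧ W k ω ∈ φ ⁻¹' {v}} :=
    ℱ.le (k + 1) _ (MeasurableSet.inter (h.measurableSet_action k a) (h.measurable_W k (hD v)))
  rw [hfun]
  refine (condExp_finsetSum (fun v _ => ((integrable_const (1 : ℝ)).indicator (hmeas v)).smul v)
    _).trans ?_
  have hall : ∀ᵐ ω ∂ℙ, ∀ v ∈ F,
      (ℙ[v • Set.indicator {ω | A k ω = a ∧ W k ω ∈ φ ⁻¹' {v}} (fun _ => (1 : ℝ)) | ℱ k]) ω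
        = v * (epsGreedy p ε (G k ω) a
          * (env.law (S k ω).1 (S k ω).2.1).real (φ ⁻¹' {v})) := by
    rw [eventually_all_finset]
    intro v _
    filter_upwards [condExp_smul v (Set.indicator {ω | A k ω = a ∧ W k ω ∈ φ ⁻¹' {v}}
      (fun _ => (1 : ℝ))) (ℱ k), h.cond_law k a _ (hD v)] with ω h1 h2
    rw [h1, Pi.smul_apply, h2, smul_eq_mul]
  filter_upwards [hall] with ω hω
  rw [Finset.sum_apply, Finset.sum_congr rfl hω, hint, Finset.mul_sum]
  exact Finset.sum_congr rfl fun v _ => by ring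

/-- The noise in the updates of a pair, weighted by the learning rates, is almost surely
summable. -/
theorem ae_exists_tendsto_noise [IsProbabilityMeasure ℙ]
    (h : env.IsQLearning ℙ ℱ α γ ε S G A W Q) (hα : ∀ n, 0 ≤ α n ∧ α n ≤ 1)
    (hsq : Summable fun n => α n ^ 2) (V : env.State → ℝ) (s : env.State) (a : p.Action) :
    ∀ᵐ ω ∂ℙ, ∃ c, Tendsto (fun n => ∑ j ∈ Finset.range n,
      stepSize α S A s a j ω * env.noise γ V s a (W j ω)) atTop (𝓝 c) := by
  classical
  obtain ⟨K, hK⟩ : ∃ K, ∀ w, |env.noise γ V s a w| ≤ K := by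
    obtain ⟨K, hK⟩ := ((finite_range_noise (env := env) γ V s a).image abs).bddAbove
    exact ⟨K, fun w => hK ⟨_, ⟨w, rfl⟩, rfl⟩⟩
  -- the part of the step size known before the action is drawn
  let c (n : ℕ) : Ω → ℝ := {ω | S n ω = s}.indicator fun ω => α (env.visits S A n ω s a)
  let g (n : ℕ) : Ω → ℝ := {ω | A n ω = a}.indicator fun ω => env.noise γ V s a (W n ω)
  have hcg (n : ℕ) : (fun ω => stepSize α S A s a n ω * env.noise γ V s a (W n ω)) = c n * g n := by
    ext ω
    by_cases h1 : S n ω = s <;> by_cases h2 : A n ω = a <;>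
      simp [stepSize, c, g, h1, h2]
  have hc (n : ℕ) : StronglyMeasurable[ℱ n] (c n) := by
    refine Measurable.stronglyMeasurable ?_
    exact ((measurable_of_countable α).comp (h.measurable_visits n s a)).indicator
      (h.measurableSet_state n s)
  have hg (n : ℕ) : StronglyMeasurable[ℱ (n + 1)] (g n) := by
    refine Measurable.stronglyMeasurable ?_
    exact ((measurable_noise γ V s a).comp (h.measurable_W n)).indicator
      (h.measurableSet_action n a)
  have hstep (n : ℕ) (ω : Ω) : |stepSize α S A s a n ω * env.noise γ V s a (W n ω)| ≤ K := by
    have h1 := stepSize_mem (S := S) (A := A) hα s a n ω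
    rw [abs_mul, abs_of_nonneg h1.1]
    calc _ ≤ 1 * |env.noise γ V s a (W n ω)| := by gcongr; exact h1.2
      _ ≤ K := by rw [one_mul]; exact hK _
  have hmeas (n : ℕ) : StronglyMeasurable[ℱ (n + 1)] (c n * g n) :=
    ((hc n).mono (ℱ.mono n.le_succ)).mul (hg n)
  have hgint (n : ℕ) : Integrable (g n) ℙ := by
    refine .of_bound ((hg n).mono (ℱ.le _)).aestronglyMeasurable K (ae_of_all _ fun ω => ?_)
    simp only [g, Set.indicator_apply, Real.norm_eq_abs]
    split_ifs
    · exact hK _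
    · simpa using (abs_nonneg _).trans (hK (W n ω))
  refine ae_exists_tendsto_sum_of_condExp_eq_zero (K := K) (R := K ^ 2 * ∑' n, α n ^ 2)
    (ℱ := ℱ) (fun n => (hcg n ▸ hmeas n)) hstep (fun n => ?_) fun n ω => ?_
  · rw [hcg]
    have hcgint : Integrable (c n * g n) ℙ :=
      .of_bound ((hmeas n).mono (ℱ.le _)).aestronglyMeasurable K
        (ae_of_all _ fun ω => by rw [← hcg]; exact hstep n ω)
    filter_upwards [condExp_mul_of_stronglyMeasurable_left (hc n) hcgint (hgint n),
      h.condExp_action_draw n a (measurable_noise γ V s a) (finite_range_noise γ V s a)]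
      with ω h1 h2
    rw [h1, Pi.mul_apply, h2, Pi.zero_apply]
    by_cases hs : S n ω = s
    · rw [hs, integral_noise, mul_zero, mul_zero]
    · rw [show c n ω = 0 from Set.indicator_of_notMem (by exact hs) _, zero_mul]
  · calc ∑ j ∈ Finset.range n, (stepSize α S A s a j ω * env.noise γ V s a (W j ω)) ^ 2
        ≤ ∑ j ∈ Finset.range n, K ^ 2 * stepSize α S A s a j ω ^ 2 := by
          refine Finset.sum_le_sum fun j _ => ?_
          rw [mul_pow, mul_comm]
          refine mul_le_mul_of_nonneg_right ?_ (sq_nonneg _)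
          rw [← sq_abs]
          exact pow_le_pow_left₀ (abs_nonneg _) (hK _) 2
      _ = K ^ 2 * ∑ j ∈ Finset.range n, stepSize α S A s a j ω ^ 2 := by rw [Finset.mul_sum]
      _ ≤ _ := by gcongr; exact sum_stepSize_sq_le hsq s a n ω

/-- Exploration: in a state that is visited infinitely often, every action is taken infinitely
often. -/
theorem ae_frequently_visit [IsProbabilityMeasure ℙ]
    (h : env.IsQLearning ℙ ℱ α γ ε S G A W Q) (hM : 0 < p.M) (hε : 0 < ε) (hε1 : ε ≤ 1)
    (s : env.State) (a : p.Action) :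
    ∀ᵐ ω ∂ℙ, (∃ᶠ k in atTop, S k ω = s) → ∃ᶠ k in atTop, S k ω = s ∧ A k ω = a := by
  classical
  set δ := ε / ((p.Nx + 1) * p.M) with hδ
  have hM' : (0 : ℝ) < p.M := by exact_mod_cast hM
  have hδ0 : 0 < δ := by positivity
  -- `E (k + 1)` is the visit of the pair in slot `k`, which is known at time `k + 1`
  let E (n : ℕ) : Set Ω := n.casesOn ∅ fun k => {ω | S k ω = s ∧ A k ω = a}
  have hE (n : ℕ) : MeasurableSet[ℱ n] (E n) := by
    cases n with
    | zero => exact @MeasurableSet.empty Ω (ℱ 0)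
    | succ k => exact h.measurableSet_visit k s a
  have hcond : ∀ᵐ ω ∂ℙ, ∀ k, {ω | S k ω = s}.indicator (fun _ => δ) ω
      ≤ (ℙ[(E (k + 1)).indicator (1 : Ω → ℝ) | ℱ k]) ω := by
    refine ae_all_iff.2 fun k => ?_
    have hA : MeasurableSet {ω | A k ω = a} := ℱ.le _ _ (h.measurableSet_action k a)
    have e : (E (k + 1)).indicator (1 : Ω → ℝ) = {ω | S k ω = s}.indicator
        ({ω | A k ω = a}.indicator fun _ => (1 : ℝ)) := by
      ext ω
      by_cases h1 : S k ω = s <;> by_cases h2 : A k ω = a <;>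
        simp [E, h1, h2]
    rw [e]
    filter_upwards [condExp_indicator ((integrable_const (1 : ℝ)).indicator hA)
        (h.measurableSet_state k s),
      h.condExp_action_draw k a (φ := fun _ => 1) measurable_const
        (Set.finite_range_const)] with ω h1 h2
    rw [h1]
    by_cases hs : S k ω = s
    · rw [Set.indicator_of_mem (by exact hs), Set.indicator_of_mem (by exact hs), h2]
      have := env.law_prob (S k ω).1 (S k ω).2.1
      have h3 : 0 ≤ (1 - ε) * (if a = G k ω then 1 else 0) :=
        mul_nonneg (sub_nonneg.2 hε1) (by split_ifs <;> norm_num)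
      simp only [integral_const, probReal_univ, smul_eq_mul, mul_one, epsGreedy]
      convert le_add_of_nonneg_left h3
    · rw [Set.indicator_of_notMem (by exact hs), Set.indicator_of_notMem (by exact hs)]
  filter_upwards [ae_mem_limsup_atTop_iff ℙ hE, hcond] with ω h1 h2 hfreq
  have hdiv : Tendsto (fun n => ∑ k ∈ Finset.range n,
      (ℙ[(E (k + 1)).indicator (1 : Ω → ℝ) | ℱ k]) ω) atTop atTop := by
    refine tendsto_atTop_mono (fun n => Finset.sum_le_sum fun k _ => h2 k) ?_
    have hnn (k : ℕ) : 0 ≤ {ω | S k ω = s}.indicator (fun _ => δ) ω :=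
      Set.indicator_nonneg (fun _ _ => hδ0.le) _
    refine (not_summable_iff_tendsto_nat_atTop_of_nonneg hnn).1 fun hsum => hfreq ?_
    filter_upwards [hsum.tendsto_atTop_zero.eventually (gt_mem_nhds hδ0)] with k hk hs
    rw [Set.indicator_of_mem (by exact hs)] at hk
    exact lt_irrefl _ hk
  have hlim := h1.2 hdiv
  rw [mem_limsup_iff_frequently_mem, frequently_atTop] at hlim
  refine frequently_atTop.2 fun m => ?_
  obtain ⟨n, hn, hω⟩ := hlim (m + 1)
  obtain ⟨k, rfl⟩ := Nat.exists_eq_add_of_le' ((Nat.le_add_left 1 m).trans hn)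
  exact ⟨k, by omega, hω⟩

/-- Almost surely, no draw falls into a null set of its conditional law. -/
theorem ae_draw_notMem [IsProbabilityMeasure ℙ] (h : env.IsQLearning ℙ ℱ α γ ε S G A W Q)
    (s : env.State) {D : Set env.Draw} (hD : MeasurableSet D)
    (h0 : env.law s.1 s.2.1 D = 0) : ∀ᵐ ω ∂ℙ, ∀ k, S k ω = s → W k ω ∉ D := by
  have key (k : ℕ) (a : p.Action) : ℙ {ω | S k ω = s ∧ A k ω = a ∧ W k ω ∈ D} = 0 := by
    have hm : MeasurableSet {ω | A k ω = a ∧ W k ω ∈ D} :=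
      ℱ.le (k + 1) _ (MeasurableSet.inter (h.measurableSet_action k a) (h.measurable_W k hD))
    have hS := h.measurableSet_state k s
    have e1 := setIntegral_condExp (ℱ.le k) ((integrable_const (1 : ℝ)).indicator hm) hS (μ := ℙ)
    have e2 : ∫ ω in {ω | S k ω = s},
        (ℙ[{ω | A k ω = a ∧ W k ω ∈ D}.indicator (fun _ => (1 : ℝ)) | ℱ k]) ω ∂ℙ = 0 := by
      refine setIntegral_eq_zero_of_ae_eq_zero ?_
      filter_upwards [h.cond_law k a D hD] with ω hω hs
      have hs' : S k ω = s := hs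
      rw [hω, hs', measureReal_def, h0, ENNReal.toReal_zero, mul_zero]
    rw [e2, setIntegral_indicator hm, setIntegral_const, smul_eq_mul, mul_one] at e1
    exact (measureReal_eq_zero_iff).1 e1.symm
  refine ae_all_iff.2 fun k => ?_
  have hall : ∀ᵐ ω ∂ℙ, ∀ a, ¬ (S k ω = s ∧ A k ω = a ∧ W k ω ∈ D) :=
    ae_all_iff.2 fun a => by rw [ae_iff]; simpa using key k a
  filter_upwards [hall] with ω hω hs hw
  exact hω _ ⟨hs, rfl, hw⟩

end IsQLearning

end Env

end MEC

/-! ### Convergence of the Q-table -/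

theorem abs_iSup_sub_iSup_le {ι : Type*} [Finite ι] [Nonempty ι] {f g : ι → ℝ} {D : ℝ}
    (h : ∀ i, |f i - g i| ≤ D) : |(⨆ i, f i) - ⨆ i, g i| ≤ D := by
  rw [abs_sub_le_iff, sub_le_iff_le_add, sub_le_iff_le_add]
  constructor <;> refine ciSup_le fun i => ?_
  · have := le_ciSup (Finite.bddAbove_range g) i
    linarith [(abs_sub_le_iff.1 (h i)).1]
  · have := le_ciSup (Finite.bddAbove_range f) i
    linarith [(abs_sub_le_iff.1 (h i)).2]

theorem eventually_frequently_eq {X : Type*} [Finite X] (u : ℕ → X) :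
    ∀ᶠ k in atTop, ∃ᶠ j in atTop, u j = u k := by
  have h : ∀ᶠ k in atTop, ∀ x, (¬ ∃ᶠ j in atTop, u j = x) → u k ≠ x :=
    eventually_all.2 fun x => by
      by_cases hx : ∃ᶠ j in atTop, u j = x
      · exact .of_forall fun k hk => absurd hx hk
      · exact (not_frequently.1 hx).mono fun k hk _ => hk
  filter_upwards [h] with k hk
  by_contra hc
  exact hk _ hc rfl

namespace MEC

namespace Env

namespace IsQLearning

variable {p : Params} {env : Env p}
variable {Ω : Type*} {mΩ : MeasurableSpace Ω} {ℙ : Measure Ω} {ℱ : Filtration ℕ mΩ} {α : ℕ → ℝ}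
  {γ ε : ℝ} {S : ℕ → Ω → env.State} {G A : ℕ → Ω → p.Action} {W : ℕ → Ω → env.Draw}
  {Q : ℕ → Ω → env.State → p.Action → ℝ} {V : env.State → ℝ}

/-- The error of an entry of the Q-table averages the noise and the discounted error in the value of
the next state. The noise does not involve the current table, but only the fixed function `V`. -/
theorem step_error (h : env.IsQLearning ℙ ℱ α γ ε S G A W Q) (V : env.State → ℝ) (k : ℕ) (ω : Ω)
    (s : env.State) (a : p.Action) :
    Q (k + 1) ω s a - env.actionValue γ V s a =
      (1 - stepSize α S A s a k ω) * (Q k ω s a - env.actionValue γ V s a)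
      + stepSize α S A s a k ω * (env.noise γ V s a (W k ω)
        + γ * ((⨆ a', Q k ω (S (k + 1) ω) a') - V (S (k + 1) ω))) := by
  rw [h.step_Q, stepSize]
  by_cases hv : S k ω = s ∧ A k ω = a
  · have hn : S (k + 1) ω = env.next s a (W k ω) := by rw [h.step_S, hv.1, hv.2]
    rw [if_pos hv, if_pos hv, noise, backup, ← hn]
    ring
  · rw [if_neg hv, if_neg hv]
    ring

/-- The Q-table stays bounded along every path, though not uniformly: the bound depends on the
initial table. -/
theorem exists_abs_table_le [Nonempty p.Action] (h : env.IsQLearning ℙ ℱ α γ ε S G A W Q)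
    (hα : ∀ n, 0 ≤ α n ∧ α n ≤ 1) (hγ : 0 ≤ γ) (hγ1 : γ < 1) (ω : Ω) :
    ∃ K, ∀ k s a, |Q k ω s a| ≤ K := by
  obtain ⟨R, hR⟩ := env.exists_abs_reward_le
  set K := max (∑ q : env.State × p.Action, |Q 0 ω q.1 q.2|) (R / (1 - γ)) with hK
  have hRK : R + γ * K ≤ K := by
    have : R / (1 - γ) ≤ K := le_max_right _ _
    rw [div_le_iff₀ (sub_pos.2 hγ1)] at this
    linarith
  refine ⟨K, fun k => ?_⟩
  induction k with
  | zero =>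
    intro s a
    exact (Finset.single_le_sum (f := fun q : env.State × p.Action => |Q 0 ω q.1 q.2|)
      (fun _ _ => abs_nonneg _) (Finset.mem_univ (s, a))).trans (le_max_left _ _)
  | succ k ih =>
    intro s a
    rw [h.step_Q]
    split_ifs
    · set c := α (env.visits S A k ω s a) with hc
      obtain ⟨h0, h1⟩ : 0 ≤ c ∧ c ≤ 1 := hα _
      have hsup : |⨆ a', Q k ω (S (k + 1) ω) a'| ≤ K := by
        simpa using abs_iSup_sub_iSup_le (f := fun a' => Q k ω (S (k + 1) ω) a')
          (g := fun _ => 0) (D := K) (fun a' => by simpa using ih (S (k + 1) ω) a')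
      have hU : |env.reward s a (W k ω) + γ * ⨆ a', Q k ω (S (k + 1) ω) a'| ≤ K := by
        refine ((abs_add_le _ _).trans (add_le_add (hR _ _ _) ?_)).trans hRK
        rw [abs_mul, abs_of_nonneg hγ]
        exact mul_le_mul_of_nonneg_left hsup hγ
      calc _ ≤ (1 - c) * K + c * K := by
            refine (abs_add_le _ _).trans ?_
            rw [abs_mul, abs_mul, abs_of_nonneg h0, abs_of_nonneg (sub_nonneg.2 h1)]
            exact add_le_add (mul_le_mul_of_nonneg_left (ih s a) (sub_nonneg.2 h1))
              (mul_le_mul_of_nonneg_left hU h0)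
        _ = K := by ring
    · exact ih s a

/-- An eventual bound `D` on the errors in all recurrent states improves to `γ * D`, up to an
arbitrarily small constant. -/
theorem eventually_error_le [Nonempty p.Action] (h : env.IsQLearning ℙ ℱ α γ ε S G A W Q)
    (hα : ∀ n, 0 ≤ α n ∧ α n ≤ 1) (hsum : ¬ Summable α) (hγ : 0 ≤ γ)
    (hV : ∀ s, V s = ⨆ a, env.actionValue γ V s a) {ω : Ω}
    (hnoise : ∀ s a, ∃ c, Tendsto (fun n => ∑ j ∈ Finset.range n,
      stepSize α S A s a j ω * env.noise γ V s a (W j ω)) atTop (𝓝 c))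
    (hvisit : ∀ s a, (∃ᶠ k in atTop, S k ω = s) → ∃ᶠ k in atTop, S k ω = s ∧ A k ω = a)
    {D : ℝ} (hD : ∀ s, (∃ᶠ k in atTop, S k ω = s) → ∀ a, ∀ᶠ k in atTop,
      |Q k ω s a - env.actionValue γ V s a| ≤ D)
    {δ : ℝ} (hδ : 0 < δ) (s : env.State) (hs : ∃ᶠ k in atTop, S k ω = s) (a : p.Action) :
    ∀ᶠ k in atTop, |Q k ω s a - env.actionValue γ V s a| ≤ γ * D + δ := by
  obtain ⟨c, hc⟩ := hnoise s a
  have hD' : ∀ᶠ k in atTop, ∀ s, (∃ᶠ j in atTop, S j ω = s) → ∀ a,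
      |Q k ω s a - env.actionValue γ V s a| ≤ D :=
    eventually_all.2 fun s => by
      by_cases hs : ∃ᶠ j in atTop, S j ω = s
      · exact (eventually_all.2 (hD s hs)).mono fun k hk _ => hk
      · exact .of_forall fun k hk => absurd hk hs
  have hnext : ∀ᶠ k in atTop, |(⨆ a', Q k ω (S (k + 1) ω) a') - V (S (k + 1) ω)| ≤ D := by
    filter_upwards [hD', (tendsto_add_atTop_nat 1).eventually
      (eventually_frequently_eq fun j => S j ω)] with k h1 h2
    rw [hV]
    exact abs_iSup_sub_iSup_le (h1 _ h2)
  set M : ℕ → ℝ := fun n => ∑ j ∈ Finset.range n,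
      stepSize α S A s a j ω * env.noise γ V s a (W j ω) with hM
  have htail : ∀ᶠ k in atTop, |M k - c| ≤ δ / 3 := by
    have := Metric.tendsto_nhds.1 hc (δ / 3) (by positivity)
    exact this.mono fun k hk => hk.le
  -- subtracting the tail `M - c` of the noise from the error leaves an averaging recursion
  have hX (k : ℕ) : Q (k + 1) ω s a - env.actionValue γ V s a - (M (k + 1) - c) =
      (1 - stepSize α S A s a k ω) * (Q k ω s a - env.actionValue γ V s a - (M k - c))
      + stepSize α S A s a k ω
        * (γ * ((⨆ a', Q k ω (S (k + 1) ω) a') - V (S (k + 1) ω)) - (M k - c)) := by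
    rw [h.step_error V]
    simp only [hM, Finset.sum_range_succ]
    ring
  have hbound : ∀ᶠ k in atTop,
      |γ * ((⨆ a', Q k ω (S (k + 1) ω) a') - V (S (k + 1) ω)) - (M k - c)| ≤ γ * D + δ / 3 := by
    filter_upwards [hnext, htail] with k h1 h2
    refine (abs_sub _ _).trans (add_le_add ?_ h2)
    rw [abs_mul, abs_of_nonneg hγ]
    exact mul_le_mul_of_nonneg_left h1 hγ
  have := eventually_abs_le_of_averaging
    (X := fun k => Q k ω s a - env.actionValue γ V s a - (M k - c))
    (fun k => stepSize_mem hα s a k ω)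
    (not_summable_stepSize (fun n => (hα n).1) hsum (hvisit s a hs)) hX hbound
    (δ := δ / 3) (by positivity)
  filter_upwards [this, htail] with k h1 h2
  have := abs_add_le (Q k ω s a - env.actionValue γ V s a - (M k - c)) (M k - c)
  rw [sub_add_cancel] at this
  linarith

/-- Almost surely, Q-learning finds the optimal values of all pairs whose state is visited
infinitely often. -/
theorem ae_tendsto_actionValue [IsProbabilityMeasure ℙ]
    (h : env.IsQLearning ℙ ℱ α γ ε S G A W Q)
    (hα : ∀ n, 0 ≤ α n ∧ α n ≤ 1) (hsum : ¬ Summable α) (hsq : Summable fun n => α n ^ 2)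
    (hγ : 0 ≤ γ) (hγ1 : γ < 1) (hε : 0 < ε) (hε1 : ε ≤ 1) (hM : 0 < p.M)
    (hV : ∀ s, V s = ⨆ a, env.actionValue γ V s a) :
    ∀ᵐ ω ∂ℙ, ∀ s, (∃ᶠ k in atTop, S k ω = s) → ∀ a,
      Tendsto (fun k => Q k ω s a) atTop (𝓝 (env.actionValue γ V s a)) := by
  have : Nonempty p.Action := ⟨(⟨0, hM⟩, 0)⟩
  have h1 := ae_all_iff.2 fun s => ae_all_iff.2 (h.ae_exists_tendsto_noise hα hsq V s)
  have h2 := ae_all_iff.2 fun s => ae_all_iff.2 (h.ae_frequently_visit hM hε hε1 s)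
  filter_upwards [h1, h2] with ω hnoise hvisit
  obtain ⟨K, hK⟩ := h.exists_abs_table_le hα hγ hγ1 ω
  set D := K + ∑ q : env.State × p.Action, |env.actionValue γ V q.1 q.2| + 1 with hDdef
  have hbase (k : ℕ) (s : env.State) (a : p.Action) :
      |Q k ω s a - env.actionValue γ V s a| ≤ D := by
    have := Finset.single_le_sum (f := fun q : env.State × p.Action =>
      |env.actionValue γ V q.1 q.2|) (fun _ _ => abs_nonneg _) (Finset.mem_univ (s, a))
    have := abs_sub (Q k ω s a) (env.actionValue γ V s a)
    have := hK k s a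
    dsimp only at *
    linarith
  have hD : 0 < D := by
    have h0 : 0 ≤ ∑ q : env.State × p.Action, |env.actionValue γ V q.1 q.2| :=
      Finset.sum_nonneg fun _ _ => abs_nonneg _
    have hK0 : 0 ≤ K := (abs_nonneg _).trans (hK 0 (S 0 ω) (Classical.arbitrary _))
    positivity
  -- each round shrinks the eventual bound by the factor `(1 + γ) / 2 < 1`
  have hgeom (n : ℕ) : ∀ s, (∃ᶠ k in atTop, S k ω = s) → ∀ a, ∀ᶠ k in atTop,
      |Q k ω s a - env.actionValue γ V s a| ≤ ((1 + γ) / 2) ^ n * D := by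
    induction n with
    | zero => exact fun s _ a => .of_forall fun k => by simpa using hbase k s a
    | succ n ih =>
      intro s hs a
      have hδ : 0 < (1 - γ) / 2 * (((1 + γ) / 2) ^ n * D) := by
        have := sub_pos.2 hγ1
        positivity
      filter_upwards [h.eventually_error_le hα hsum hγ hV hnoise hvisit ih hδ s hs a] with k hk
      refine hk.trans (le_of_eq ?_)
      ring
  intro s hs a
  refine Metric.tendsto_nhds.2 fun η hη => ?_
  have hlim : Tendsto (fun n : ℕ => ((1 + γ) / 2) ^ n * D) atTop (𝓝 0) := by
    simpa using (tendsto_pow_atTop_nhds_zero_of_lt_one (by positivity)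
      (by linarith : (1 + γ) / 2 < 1)).mul_const D
  obtain ⟨n, hn⟩ := (hlim.eventually (gt_mem_nhds hη)).exists
  exact (hgeom n s hs a).mono fun k hk => hk.trans_lt hn

/-! ### Greedy actions -/

theorem ae_eventually_actionValue_greedy
    (h : env.IsQLearning ℙ ℱ α γ ε S G A W Q) {a₀ : p.Action}
    (hle : ∀ s a, env.actionValue γ V s a ≤ env.actionValue γ V s a₀)
    (hlim : ∀ᵐ ω ∂ℙ, ∀ s, (∃ᶠ k in atTop, S k ω = s) → ∀ a,
      Tendsto (fun k => Q k ω s a) atTop (𝓝 (env.actionValue γ V s a))) :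
    ∀ᵐ ω ∂ℙ, ∀ᶠ k in atTop,
      env.actionValue γ V (S k ω) (G k ω) = env.actionValue γ V (S k ω) a₀ := by
  filter_upwards [hlim] with ω hω
  have hlt : ∀ᶠ k in atTop, ∀ s a, (∃ᶠ j in atTop, S j ω = s) →
      env.actionValue γ V s a < env.actionValue γ V s a₀ → Q k ω s a < Q k ω s a₀ := by
    refine eventually_all.2 fun s => eventually_all.2 fun a => ?_
    by_cases hs : ∃ᶠ j in atTop, S j ω = s
    · by_cases ha : env.actionValue γ V s a < env.actionValue γ V s a₀
      · exact ((hω s hs a).eventually_lt (hω s hs a₀) ha).mono fun k hk _ _ => hk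
      · exact .of_forall fun k _ h' => absurd h' ha
    · exact .of_forall fun k h' => absurd h' hs
  filter_upwards [hlt, eventually_frequently_eq fun j => S j ω] with k h1 h2
  refine (hle _ _).antisymm (not_lt.1 fun hc => ?_)
  exact (h1 _ _ h2 hc).not_ge (h.greedy k ω a₀)

/-- Almost surely, in every slot, an action that ties with full offloading in its expected value
earns exactly the reward of full offloading. -/
theorem ae_reward_eq_full [IsProbabilityMeasure ℙ] (h : env.IsQLearning ℙ ℱ α γ ε S G A W Q)
    {a₀ : p.Action}
    (htie : ∀ s a, env.actionValue γ V s a = env.actionValue γ V s a₀ →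
      ∀ᵐ w ∂env.law s.1 s.2.1, env.reward s a w = env.reward s a₀ w) :
    ∀ᵐ ω ∂ℙ, ∀ k a,
      env.actionValue γ V (S k ω) a = env.actionValue γ V (S k ω) a₀ →
      env.reward (S k ω) a (W k ω) = env.reward (S k ω) a₀ (W k ω) := by
  have hall : ∀ᵐ ω ∂ℙ, ∀ s a, env.actionValue γ V s a = env.actionValue γ V s a₀ →
      ∀ k, S k ω = s → env.reward s a (W k ω) = env.reward s a₀ (W k ω) := by
    refine ae_all_iff.2 fun s => ae_all_iff.2 fun a => ?_
    by_cases he : env.actionValue γ V s a = env.actionValue γ V s a₀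
    · have hD : MeasurableSet {w | ¬ env.reward s a w = env.reward s a₀ w} :=
        (measurableSet_eq_fun (env.measurable_reward s a) (env.measurable_reward s a₀)).compl
      filter_upwards [h.ae_draw_notMem s hD (ae_iff.1 (htie s a he))] with ω hω _ k hk
      exact not_not.1 (hω k hk)
    · exact ae_of_all _ fun ω h' => absurd h' he
  filter_upwards [hall] with ω hω k a ha
  exact hω _ a ha k rfl

theorem ae_tendsto_iSup_sub {a₀ : p.Action}
    (hV : ∀ s, V s = ⨆ a, env.actionValue γ V s a)
    (hV₀ : ∀ s, V s = env.actionValue γ V s a₀)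
    (hlim : ∀ᵐ ω ∂ℙ, ∀ s, (∃ᶠ k in atTop, S k ω = s) → ∀ a,
      Tendsto (fun k => Q k ω s a) atTop (𝓝 (env.actionValue γ V s a))) :
    ∀ᵐ ω ∂ℙ, Tendsto (fun k => (⨆ a, Q k ω (S k ω) a) - Q k ω (S k ω) a₀) atTop (𝓝 0) := by
  have : Nonempty p.Action := ⟨a₀⟩
  filter_upwards [hlim] with ω hω
  refine Metric.tendsto_nhds.2 fun η hη => ?_
  have hclose : ∀ᶠ k in atTop, ∀ s a, (∃ᶠ j in atTop, S j ω = s) →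
      |Q k ω s a - env.actionValue γ V s a| ≤ η / 3 := by
    refine eventually_all.2 fun s => eventually_all.2 fun a => ?_
    by_cases hs : ∃ᶠ j in atTop, S j ω = s
    · exact (Metric.tendsto_nhds.1 (hω s hs a) (η / 3) (by positivity)).mono fun k hk _ => hk.le
    · exact .of_forall fun k h' => absurd h' hs
  filter_upwards [hclose, eventually_frequently_eq fun j => S j ω] with k h1 h2
  have h3 := abs_iSup_sub_iSup_le fun a => h1 _ a h2
  have h4 := h1 _ a₀ h2
  rw [← hV] at h3
  rw [← hV₀] at h4
  rw [Real.dist_eq, sub_zero]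
  have := abs_sub_le (⨆ a, Q k ω (S k ω) a) (V (S k ω)) (Q k ω (S k ω) a₀)
  rw [abs_sub_comm (V (S k ω))] at this
  linarith

end IsQLearning

end Env

end MEC

theorem theorem1 (p : MEC.Params) (env : MEC.Env p) (i₀ : Fin p.M)
    (hmax : ∀ B ∈ env.bands, ∀ i, B i ≤ B i₀)
    (hcond : ∀ B ∈ env.bands,
      max ((p.μ + p.β * p.P) / (p.β * p.cap * p.N * p.f ^ 2 + 1))
        (p.P / (p.cap * p.N * p.f ^ 2)) ≤ B i₀) :
    -- in every single slot, `[i₀, 1]` is optimal among all actions `[i, x]`, `0 ≤ x ≤ 1`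
    (∀ B ∈ env.bands, ∀ b ρ : ℝ,
      (∀ i, ∀ x ∈ Set.Icc (0 : ℝ) 1, p.utility b ρ (B i) x ≤ p.utility b ρ (B i₀) 1) ∧
      p.utility b ρ (B i₀) 1 = p.C * ((B i₀ - p.β * p.P - p.μ) / B i₀)
        - p.ψ * (if b - p.P * p.C / B i₀ + ρ ≤ 0 then 1 else 0)) ∧
    -- Q-learning attains it almost surely after sufficiently many slots
    (∀ {Ω : Type*} {mΩ : MeasurableSpace Ω} (ℙ : Measure Ω) [IsProbabilityMeasure ℙ]
      (ℱ : Filtration ℕ mΩ) (α : ℕ → ℝ) (γ ε : ℝ)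
      (S : ℕ → Ω → env.State) (G A : ℕ → Ω → p.Action) (W : ℕ → Ω → env.Draw)
      (Q : ℕ → Ω → env.State → p.Action → ℝ),
      (∀ n, 0 ≤ α n ∧ α n ≤ 1) → ¬ Summable α → Summable (fun n => α n ^ 2) →
      0 ≤ γ → γ < 1 → 0 < ε → ε ≤ 1 →
      env.IsQLearning ℙ ℱ α γ ε S G A W Q →
      -- the greedy action has the utility of `[i₀, 1]` in all slots from some slot on
      (∀ᵐ ω ∂ℙ, ∀ᶠ k in atTop,
        env.reward (S k ω) (G k ω) (W k ω) = env.reward (S k ω) (p.full i₀) (W k ω) ∧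
        env.reward (S k ω) (G k ω) (W k ω) =
          p.C * (((W k ω).1.1 i₀ - p.β * p.P - p.μ) / (W k ω).1.1 i₀)
            - p.ψ * (if ((S k ω).2.2 : ℝ) - p.P * p.C / (W k ω).1.1 i₀ + (W k ω).2.1 ≤ 0
                then 1 else 0)) ∧
      -- in the limit, the learned Q-value of `[i₀, 1]` is maximal
      (∀ᵐ ω ∂ℙ, Tendsto
        (fun k => (⨆ a, Q k ω (S k ω) a) - Q k ω (S k ω) (p.full i₀)) atTop (𝓝 0)) ∧
      -- without ties, the greedy action is `[i₀, 1]` itself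
      (0 < p.μ + p.β * p.P →
        (∀ B ∈ env.bands,
          (p.μ + p.β * p.P) / (p.β * p.cap * p.N * p.f ^ 2 + 1) < B i₀ ∧
          ∀ i, i ≠ i₀ → B i < B i₀) →
        ∀ᵐ ω ∂ℙ, ∀ᶠ k in atTop, G k ω = p.full i₀)) := by
  have hpos (B) (hB : B ∈ env.bands) : 0 < B i₀ := env.bands_pos B hB i₀
  refine ⟨fun B hB b ρ => ⟨fun i x hx => p.utility_le_full ρ le_rfl (env.bands_pos B hB i)
    (hmax B hB i) (hcond B hB) hx, p.utility_full b ρ (hpos B hB)⟩, ?_⟩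
  intro Ω mΩ ℙ _ ℱ α γ ε S G A W Q hα hsum hsq hγ hγ1 hε hε1 h
  obtain ⟨V, hV⟩ := env.exists_isFullValue hγ hγ1 i₀
  have hopt := MEC.Env.IsFullValue.eq_iSup hmax hcond hγ hγ1 hV
  have hlim := h.ae_tendsto_actionValue hα hsum hsq hγ hγ1 hε hε1 i₀.pos hopt
  have hgreedy := h.ae_eventually_actionValue_greedy
    (MEC.Env.actionValue_le_full hmax hcond hγ hγ1 hV) hlim
  have htie (s : env.State) (a : p.Action)
      (hs : env.actionValue γ V s a = env.actionValue γ V s (p.full i₀)) :=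
    MEC.Env.reward_eq_full_ae hmax hcond hγ hγ1 hV hs
  refine ⟨?_, MEC.Env.IsQLearning.ae_tendsto_iSup_sub hopt hV hlim, fun hμ hstrict => ?_⟩
  · filter_upwards [hgreedy, h.ae_reward_eq_full htie] with ω h1 h2
    filter_upwards [h1] with k hk
    have he := h2 k _ hk
    refine ⟨he, he.trans ?_⟩
    rw [MEC.Env.reward, p.rate_full]
    exact p.utility_full _ _ (hpos _ (W k ω).1.2)
  · filter_upwards [hgreedy] with ω h1
    filter_upwards [h1] with k hk
    by_contra hne
    have := env.law_prob (S k ω).1 (S k ω).2.1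
    obtain ⟨w, hw⟩ := (htie _ _ hk).exists
    have hlt := p.utility_lt_full (S k ω).2.2 w.2.1 (env.bands_pos _ w.1.2)
      ((le_max_right _ _).trans (hcond _ w.1.2)) (hstrict _ w.1.2).1 (hstrict _ w.1.2).2 hμ hne
    rw [MEC.Env.reward, MEC.Env.reward, p.rate_full] at hw
    exact hlt.ne hw
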